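/- Let $\varepsilon>0$, let $m_0\in\mathbb R^2$, and let $(p_i)_{i\in\mathbb N}$, $\mathbb N=\{0,1,2,\dots\}$, be a sequence of points of the Euclidean plane (not necessarily distinct) with $p_i\neq m_0$ for all $i$. A path of speed at most $v$ starting at $p$ is a function $\gamma\colon[0,\infty)\to\mathbb R^2$ with $\gamma(0)=p$ and $\|\gamma(s)-\gamma(t)\|\le v|s-t|$ for all $s,t\ge 0$. A path of lion $i$ is a path of speed at most $1$ starting at $p_i$; a man path is a path of speed at most $1+\varepsilon$ starting at $m_0$. A strategy of the man against a family of lions is a map $M$ that assigns to every family $l=(l_i)_i$ of paths of these lions a man path $M(l)$ and is non-anticipative: if $l$ and $l'$ agree on $[0,t)$ (for every lion), then $M(l)$ and $M(l')$ agree on $[0,t]$. It is winning if $M(l)(t)\ne l_i(t)$ for all $l$, all $t\ge 0$ and every lion $i$ of the family. Then the man has a winning strategy $M$ against all the lions $0,1,2,\dots$. Moreover, $M$ can be chosen together with winning strategies $M_n$ against the finitely many lions $0,\dots,n$, for every $n\in\mathbb N$, and with positive reals $c_0,c_1,\dots$ and $\delta_0,\delta_1,\dots$ with $\sum_n\delta_n<\infty$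 and $\sum_{j\ge i}\delta_j\le c_i/2$ for every $i$, such that for all lion paths $l=(l_i)_{i\in\mathbb N}$ and all $t\ge0$, writing $M_n(t)=M_n(l_0,\dots,l_n)(t)$ and $M(t)=M(l)(t)$: 1. $\|M_n(t)-l_n(t)\|\ge c_n$ for all $n$; 2. $\|M_n(t)-M_{n+1}(t)\|\le\delta_n$ for all $n$; 3. $\|M_n(t)-l_i(t)\|\ge c_i/2$ for all $i\le n$; 4. $M_n(t)\to M(t)$ as $n\to\infty$; 5. $\|M(t)-l_i(t)\|\ge c_i/2$ for all $i$. -/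

import Mathlib

open Filter Topology
open scoped NNReal

namespace LionMan

/-- The Euclidean plane. -/
abbrev Plane : Type := EuclideanSpace ℝ (Fin 2)

/-- Paths `[0, ∞) → ℝ²` that start at `p` and have speed at most `v`. -/
abbrev PathFrom (v : ℝ) (p : Plane) : Type :=
  {γ : ℝ≥0 → Plane // γ 0 = p ∧ ∀ s t : ℝ≥0, ‖γ s - γ t‖ ≤ v * |(s : ℝ) - (t : ℝ)|}

/-- Families of unit speed lion paths; lion `i` starts at `l₀ i`. -/
abbrev LionPaths {ι : Type} (l₀ : ι → Plane) : Type :=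
  ∀ i : ι, PathFrom 1 (l₀ i)

/-- A strategy for a man of speed `1 + ε` starting at `m₀`, against lions starting at the points
`l₀ i`: a map from families of lion paths to man paths such that, if two families agree on
`[0, t)`, then the man paths agree on `[0, t]`. -/
structure Strategy (ε : ℝ) (m₀ : Plane) {ι : Type} (l₀ : ι → Plane) where
  /-- The man path chosen against given lion paths. -/
  path : LionPaths l₀ → PathFrom (1 + ε) m₀
  nonanticipative : ∀ (l l' : LionPaths l₀) (t : ℝ≥0),
    (∀ i, ∀ s < t, (l i).1 s = (l' i).1 s) → ∀ s ≤ t, (path l).1 s = (path l').1 s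

/-- The man is never caught by any lion. -/
def Strategy.Winning {ε : ℝ} {m₀ : Plane} {ι : Type} {l₀ : ι → Plane}
    (M : Strategy ε m₀ l₀) : Prop :=
  ∀ (l : LionPaths l₀) (t : ℝ≥0) (i : ι), (M.path l).1 t ≠ (l i).1 t

/-- The starting points of the lions `0, …, n`. -/
abbrev initialPoints (l₀ : ℕ → Plane) (n : ℕ) : Fin (n + 1) → Plane :=
  fun i => l₀ i

/-- The paths of the lions `0, …, n`. -/
abbrev LionPaths.initial {l₀ : ℕ → Plane} (l : LionPaths l₀) (n : ℕ) :
    LionPaths (initialPoints l₀ n) :=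
  fun i => l i

end LionMan

/-! One lion is evaded as follows (`exists_evasion`). The man follows a guide path `g` of speed `v`
at the larger speed `V = v + σ`. He proceeds in steps, and in each step he runs in a fixed
direction, towards where the guide was at the start of the step. If the lion comes within `r`, he
circles it at relative speed `σ`, staying at distance `r`, until he is on the side he was running
to. He then runs on in the same direction and, being faster than the lion, is not approached again.
So each step contains at most one detour, of duration `2πr/σ`. For small `r` the surplus speed makes
up for the detours, and the man stays near the guide. The distance `r` depends only on the speeds,
the tolerance and the initial distance, not on the paths.

For infinitely many lions this is iterated (`exists_evasion_sequence`): path `n` evades lion `n` and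
uses path `n - 1` as its guide, with speeds increasing but bounded by `1 + ε`. The tolerances are so
small compared with all earlier `c i` that the total later drift costs at most half of `c i`. The
paths therefore converge, and the limit keeps distance `c i / 2` from lion `i`. Every construction
looks only at the past, and so does the limit. -/

namespace LionMan

/-! ### Speed bounds and directions. -/

/-- The path `γ` has speed at most `v` on the set `A` of times. -/
def SpeedOn (v : ℝ) (γ : ℝ → Plane) (A : Set ℝ) : Prop :=
  ∀ s ∈ A, ∀ t ∈ A, s ≤ t → ‖γ t - γ s‖ ≤ v * (t - s)

lemma SpeedOn.mono {v : ℝ} {γ : ℝ → Plane} {A B : Set ℝ} (h : SpeedOn v γ B) (hAB : A ⊆ B) :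
    SpeedOn v γ A :=
  fun s hs t ht => h s (hAB hs) t (hAB ht)

lemma SpeedOn.congr {v : ℝ} {γ γ' : ℝ → Plane} {A : Set ℝ} (h : SpeedOn v γ A)
    (hγ : Set.EqOn γ' γ A) : SpeedOn v γ' A := by
  intro s hs t ht hst
  rw [hγ hs, hγ ht]
  exact h s hs t ht hst

lemma SpeedOn.glue {v a b c : ℝ} {γ : ℝ → Plane} (h₁ : SpeedOn v γ (Set.Icc a b))
    (h₂ : SpeedOn v γ (Set.Icc b c)) : SpeedOn v γ (Set.Icc a c) := by
  intro s hs t ht hst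
  rcases le_total t b with htb | htb
  · exact h₁ s ⟨hs.1, hst.trans htb⟩ t ⟨ht.1, htb⟩ hst
  rcases le_total s b with hsb | hsb
  · have e₁ := h₁ s ⟨hs.1, hsb⟩ b ⟨hs.1.trans hsb, le_rfl⟩ hsb
    have e₂ := h₂ b ⟨le_rfl, htb.trans ht.2⟩ t ⟨htb, ht.2⟩ htb
    have := norm_sub_le_norm_sub_add_norm_sub (γ t) (γ b) (γ s)
    linarith
  · exact h₂ s ⟨hsb, hs.2⟩ t ⟨htb, ht.2⟩ hst

/-- Gluing along a grid of mesh `T`. -/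
lemma SpeedOn.of_grid {v T : ℝ} (hT : 0 < T) {γ : ℝ → Plane}
    (h : ∀ k : ℕ, SpeedOn v γ (Set.Icc (k * T) ((k + 1 : ℕ) * T))) :
    SpeedOn v γ (Set.Ici 0) := by
  have key : ∀ k : ℕ, SpeedOn v γ (Set.Icc 0 (k * T)) := by
    intro k
    induction k with
    | zero => exact (h 0).mono (Set.Icc_subset_Icc (by simp) (by simp [hT.le]))
    | succ k ih => exact ih.glue (h k)
  intro s hs t ht hst
  obtain ⟨k, hk⟩ := exists_nat_ge (t / T)
  have hk' : t ≤ k * T := (div_le_iff₀ hT).1 hk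
  exact key k s ⟨hs, hst.trans hk'⟩ t ⟨ht, hk'⟩ hst

lemma speedOn_run (p e : Plane) (he : ‖e‖ = 1) {V : ℝ} (hV : 0 ≤ V) (a : ℝ) (A : Set ℝ) :
    SpeedOn V (fun τ => p - (V * (τ - a)) • e) A := by
  intro s _ t _ hst
  have : p - (V * (t - a)) • e - (p - (V * (s - a)) • e) = -((V * (t - s)) • e) := by
    module
  rw [this, norm_neg, norm_smul, he, mul_one, Real.norm_of_nonneg]
  exact mul_nonneg hV (by linarith)

/-- Every vector of the plane is a nonnegative multiple of a unit vector. -/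
lemma exists_direction (x : Plane) : ∃ e : Plane, ‖e‖ = 1 ∧ x = ‖x‖ • e := by
  by_cases hx : x = 0
  · obtain ⟨e, he⟩ := exists_norm_eq Plane (zero_le_one (α := ℝ))
    exact ⟨e, he, by simp [hx]⟩
  · refine ⟨‖x‖⁻¹ • x, norm_smul_inv_norm hx, ?_⟩
    rw [smul_inv_smul₀ (norm_ne_zero_iff.2 hx)]

/-- A unit vector in the direction of `x`. -/
noncomputable def direction (x : Plane) : Plane := (exists_direction x).choose

lemma norm_direction (x : Plane) : ‖direction x‖ = 1 := (exists_direction x).choose_spec.1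

lemma norm_smul_direction (x : Plane) : x = ‖x‖ • direction x :=
  (exists_direction x).choose_spec.2

/-! ### Circling the lion, in the frame of the lion. -/

/-- The time in which a point of speed `σ` makes a full turn on a circle of radius `r`. -/
noncomputable def turnTime (σ r : ℝ) : ℝ := 2 * Real.pi * r / σ

lemma turnTime_pos {σ r : ℝ} (hσ : 0 < σ) (hr : 0 < r) : 0 < turnTime σ r := by
  unfold turnTime; positivity

/-- A path of speed `σ` on the circle of radius `r` in the complex plane that joins two given
points in time `turnTime σ r`. -/
lemma exists_complex_orbit {σ r : ℝ} (hσ : 0 < σ) (hr : 0 < r) (y z : ℂ) (hy : ‖y‖ = r)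
    (hz : ‖z‖ = r) :
    ∃ f : ℝ → ℂ, f 0 = y ∧ (∀ τ, ‖f τ‖ = r) ∧ (∀ s t, s ≤ t → ‖f t - f s‖ ≤ σ * (t - s)) ∧
      f (turnTime σ r) = z := by
  have hT := turnTime_pos hσ hr
  -- Interpolate the arguments linearly. They differ by at most `2π`, so the speed is at most `2πr /
  -- turnTime σ r = σ`.
  set ω : ℝ := (z.arg - y.arg) / turnTime σ r with hω
  have hωle : r * |ω| ≤ σ := by
    have h : |z.arg - y.arg| ≤ 2 * Real.pi := by
      rw [abs_le]
      constructor <;>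
        linarith [Complex.neg_pi_lt_arg z, Complex.arg_le_pi z, Complex.neg_pi_lt_arg y,
          Complex.arg_le_pi y]
    rw [hω, abs_div, abs_of_pos hT, ← mul_div_assoc, div_le_iff₀ hT]
    calc r * |z.arg - y.arg| ≤ r * (2 * Real.pi) := by gcongr
      _ = σ * turnTime σ r := by unfold turnTime; field_simp
  have hexp : ∀ x : ℝ, ‖Complex.exp (x * Complex.I)‖ = 1 := Complex.norm_exp_ofReal_mul_I
  refine ⟨fun τ => r * Complex.exp ((y.arg + ω * τ : ℝ) * Complex.I), ?_, ?_, ?_, ?_⟩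
  · simpa [hy] using Complex.norm_mul_exp_arg_mul_I y
  · intro τ
    rw [norm_mul, hexp, mul_one, Complex.norm_real, Real.norm_of_nonneg hr.le]
  · intro s t hst
    have h1 : (r : ℂ) * Complex.exp ((y.arg + ω * t : ℝ) * Complex.I)
        - r * Complex.exp ((y.arg + ω * s : ℝ) * Complex.I)
        = r * Complex.exp ((y.arg + ω * s : ℝ) * Complex.I)
          * (Complex.exp (Complex.I * (ω * (t - s) : ℝ)) - 1) := by
      rw [mul_sub, mul_assoc, ← Complex.exp_add]
      push_cast
      ring_nf
    rw [h1, norm_mul, norm_mul, hexp, mul_one, Complex.norm_real, Real.norm_of_nonneg hr.le]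
    calc r * ‖Complex.exp (Complex.I * (ω * (t - s) : ℝ)) - 1‖ ≤ r * ‖ω * (t - s)‖ := by
          gcongr
          exact Real.norm_exp_I_mul_ofReal_sub_one_le
      _ = r * |ω| * (t - s) := by
          rw [norm_mul, Real.norm_eq_abs, Real.norm_of_nonneg (sub_nonneg.2 hst), mul_assoc]
      _ ≤ σ * (t - s) := by
          have := sub_nonneg.2 hst
          gcongr
  · have : y.arg + ω * turnTime σ r = z.arg := by
      rw [hω, div_mul_cancel₀ _ hT.ne']; ring
    simp only [this]
    simpa [hz] using Complex.norm_mul_exp_arg_mul_I z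

/-- A path of speed `σ` that starts at `y`, keeps its distance to the origin and, if `y` lies on
the circle of radius `r`, reaches the point `-r • e` of that circle in time `turnTime σ r`. -/
lemma exists_orbit {σ r : ℝ} (hσ : 0 < σ) (hr : 0 < r) (y e : Plane) (he : ‖e‖ = 1) :
    ∃ f : ℝ → Plane, f 0 = y ∧ (∀ τ, ‖f τ‖ = ‖y‖) ∧ SpeedOn σ f Set.univ ∧
      (‖y‖ = r → f (turnTime σ r) = -(r • e)) := by
  by_cases hy : ‖y‖ = r
  · let Φ := Complex.orthonormalBasisOneI.repr
    obtain ⟨f, h0, hn, hs, hT⟩ := exists_complex_orbit hσ hr (Φ.symm y) (Φ.symm (-(r • e)))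
      (by rw [Φ.symm.norm_map, hy])
      (by rw [Φ.symm.norm_map, norm_neg, norm_smul, he, mul_one, Real.norm_of_nonneg hr.le])
    refine ⟨fun τ => Φ (f τ), by simp [h0], fun τ => by rw [Φ.norm_map, hn, hy], ?_, ?_⟩
    · intro s _ t _ hst
      rw [← map_sub, Φ.norm_map]
      exact hs s t hst
    · intro _
      simp only [hT, LinearIsometryEquiv.apply_symm_apply]
  -- Off the circle the man just keeps his position relative to the lion; this is used only when a
  -- run ends at `T₁` without an encounter.
  · refine ⟨fun _ => y, rfl, fun _ => rfl, ?_, fun h => absurd h hy⟩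
    intro s _ t _ hst
    simpa using mul_nonneg hσ.le (sub_nonneg.2 hst)

open Classical in
/-- A choice of the path of `exists_orbit`. -/
noncomputable def orbit (σ r : ℝ) (y e : Plane) : ℝ → Plane :=
  if h : 0 < σ ∧ 0 < r ∧ ‖e‖ = 1 then (exists_orbit h.1 h.2.1 y e h.2.2).choose else fun _ => y

lemma orbit_spec {σ r : ℝ} (hσ : 0 < σ) (hr : 0 < r) (y : Plane) {e : Plane} (he : ‖e‖ = 1) :
    orbit σ r y e 0 = y ∧ (∀ τ, ‖orbit σ r y e τ‖ = ‖y‖) ∧ SpeedOn σ (orbit σ r y e) Set.univ ∧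
      (‖y‖ = r → orbit σ r y e (turnTime σ r) = -(r • e)) := by
  unfold orbit
  rw [dif_pos ⟨hσ, hr, he⟩]
  exact (exists_orbit hσ hr y e he).choose_spec

/-! ### The time of the encounter. -/

/-- The first time in `[0, T₁]` at which a man who runs from `p` with velocity `-V • e` is within
distance `r` of the lion `ℓ`, or `T₁` if there is none. -/
noncomputable def hitTime (V r T₁ : ℝ) (p e : Plane) (ℓ : ℝ → Plane) : ℝ :=
  sInf {τ | 0 ≤ τ ∧ τ ≤ T₁ ∧ (‖p - (V * τ) • e - ℓ τ‖ ≤ r ∨ τ = T₁)}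

section hitTime

variable {V r T₁ : ℝ} {p e : Plane} {ℓ ℓ' : ℝ → Plane}

lemma hitTime_le {τ : ℝ} (h0 : 0 ≤ τ) (h1 : τ ≤ T₁)
    (h : ‖p - (V * τ) • e - ℓ τ‖ ≤ r ∨ τ = T₁) : hitTime V r T₁ p e ℓ ≤ τ :=
  csInf_le ⟨0, fun _ h => h.1⟩ ⟨h0, h1, h⟩

lemma hitTime_mem (hT₁ : 0 ≤ T₁) (hℓ : ContinuousOn ℓ (Set.Ici 0)) :
    0 ≤ hitTime V r T₁ p e ℓ ∧ hitTime V r T₁ p e ℓ ≤ T₁ ∧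
      (‖p - (V * hitTime V r T₁ p e ℓ) • e - ℓ (hitTime V r T₁ p e ℓ)‖ ≤ r ∨
        hitTime V r T₁ p e ℓ = T₁) := by
  have hc : IsClosed {τ | 0 ≤ τ ∧ τ ≤ T₁ ∧ (‖p - (V * τ) • e - ℓ τ‖ ≤ r ∨ τ = T₁)} := by
    have h1 : IsClosed (Set.Icc 0 T₁ ∩
        (fun τ => ‖p - (V * τ) • e - ℓ τ‖) ⁻¹' Set.Iic r) := by
      refine ContinuousOn.preimage_isClosed_of_isClosed ?_ isClosed_Icc isClosed_Iic
      have := hℓ.mono fun τ (hτ : τ ∈ Set.Icc 0 T₁) => hτ.1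
      fun_prop
    convert h1.union (isClosed_singleton (x := T₁)) using 1
    ext τ
    simp only [Set.mem_ofPred_eq, Set.mem_union, Set.mem_inter_iff, Set.mem_Icc, Set.mem_preimage,
      Set.mem_Iic, Set.mem_singleton_iff]
    constructor
    · rintro ⟨h0, h1, h | h⟩
      · exact Or.inl ⟨⟨h0, h1⟩, h⟩
      · exact Or.inr h
    · rintro (⟨⟨h0, h1⟩, h⟩ | rfl)
      · exact ⟨h0, h1, Or.inl h⟩
      · exact ⟨hT₁, le_rfl, Or.inr rfl⟩
  exact hc.csInf_mem ⟨T₁, hT₁, le_rfl, Or.inr rfl⟩ ⟨0, fun _ h => h.1⟩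

/-- Up to the hitting time the man is at distance at least `r` from the lion. -/
lemma le_norm_of_le_hitTime (hT₁ : 0 ≤ T₁) (hℓ : ContinuousOn ℓ (Set.Ici 0))
    (h0 : r ≤ ‖p - ℓ 0‖) {τ : ℝ} (hτ0 : 0 ≤ τ) (hτ : τ ≤ hitTime V r T₁ p e ℓ) :
    r ≤ ‖p - (V * τ) • e - ℓ τ‖ := by
  have hlt : ∀ s, 0 ≤ s → s < hitTime V r T₁ p e ℓ → r ≤ ‖p - (V * s) • e - ℓ s‖ := by
    intro s hs0 hs
    by_contra! hcon
    exact (hitTime_le hs0 (hs.le.trans (hitTime_mem hT₁ hℓ).2.1) (Or.inl hcon.le)).not_gt hs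
  rcases hτ.lt_or_eq with h | h
  · exact hlt τ hτ0 h
  -- At the hitting time the bound is a limit from the left, except at time `0`, where only the
  -- initial distance can give it.
  rcases hτ0.eq_or_lt with rfl | hpos
  · simpa using h0
  have hcont : ContinuousWithinAt (fun s => ‖p - (V * s) • e - ℓ s‖) (Set.Ico 0 τ) τ := by
    have := (hℓ τ hτ0).mono fun s (hs : s ∈ Set.Ico 0 τ) => hs.1
    fun_prop
  have hmem : τ ∈ closure (Set.Ico 0 τ) := by
    rw [closure_Ico hpos.ne]
    exact ⟨hτ0, le_rfl⟩
  have := mem_closure_iff_nhdsWithin_neBot.1 hmem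
  exact ge_of_tendsto hcont (eventually_nhdsWithin_of_forall fun s hs => hlt s hs.1 (hs.2.trans_eq h))

lemma hitTime_le_hitTime (hT₁ : 0 ≤ T₁) (hℓ : ContinuousOn ℓ (Set.Ici 0)) {τ : ℝ}
    (h : ∀ s, 0 ≤ s → s ≤ τ → ℓ s = ℓ' s) (hτ : hitTime V r T₁ p e ℓ ≤ τ) :
    hitTime V r T₁ p e ℓ' ≤ hitTime V r T₁ p e ℓ := by
  obtain ⟨h0, h1, h2⟩ := hitTime_mem (V := V) (r := r) (p := p) (e := e) hT₁ hℓ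
  refine hitTime_le h0 h1 ?_
  rwa [← h _ h0 hτ]

/-- The hitting time is a stopping time: if it has come by `τ`, the lion's path up to `τ` determines
it. This is the source of non-anticipativity. -/
lemma hitTime_congr (hT₁ : 0 ≤ T₁) (hℓ : ContinuousOn ℓ (Set.Ici 0))
    (hℓ' : ContinuousOn ℓ' (Set.Ici 0)) {τ : ℝ}
    (h : ∀ s, 0 ≤ s → s ≤ τ → ℓ s = ℓ' s) (hτ : hitTime V r T₁ p e ℓ ≤ τ) :
    hitTime V r T₁ p e ℓ = hitTime V r T₁ p e ℓ' := by
  have h1 := hitTime_le_hitTime hT₁ hℓ h hτ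
  exact le_antisymm
    (hitTime_le_hitTime hT₁ hℓ' (fun s h0 hs => (h s h0 hs).symm) (h1.trans hτ)) h1

end hitTime

/-! ### A single evasive step. -/

/-- The evasive step: run from `p` with velocity `-V • e` until the lion `ℓ` is within distance `r`
(or until time `T₁`), then follow an orbit in the frame of the lion for the time `turnTime σ r`,
and then run with velocity `-V • e` again. -/
noncomputable def stepPath (V σ r T₁ : ℝ) (p e : Plane) (ℓ : ℝ → Plane) (τ : ℝ) : Plane :=
  let a := hitTime V r T₁ p e ℓ
  let f := orbit σ r (p - (V * a) • e - ℓ a) e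
  let b := a + turnTime σ r
  if τ ≤ a then p - (V * τ) • e
  else if τ ≤ b then ℓ τ + f (τ - a)
  else ℓ b + f (turnTime σ r) - (V * (τ - b)) • e

section stepPath

variable {V σ r T₁ : ℝ} {p e : Plane} {ℓ ℓ' : ℝ → Plane}

lemma stepPath_of_le {τ : ℝ} (h : τ ≤ hitTime V r T₁ p e ℓ) :
    stepPath V σ r T₁ p e ℓ τ = p - (V * τ) • e := by
  simp [stepPath, h]

lemma stepPath_of_mem (hσ : 0 < σ) (hr : 0 < r) (he : ‖e‖ = 1) {τ : ℝ}
    (h : hitTime V r T₁ p e ℓ ≤ τ) (h' : τ ≤ hitTime V r T₁ p e ℓ + turnTime σ r) :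
    stepPath V σ r T₁ p e ℓ τ = ℓ τ + orbit σ r (p - (V * hitTime V r T₁ p e ℓ) • e
      - ℓ (hitTime V r T₁ p e ℓ)) e (τ - hitTime V r T₁ p e ℓ) := by
  rcases h.eq_or_lt with h | h
  · rw [stepPath_of_le h.ge, ← h, sub_self, (orbit_spec hσ hr _ he).1]
    abel
  · simp [stepPath, h.not_ge, h']

lemma stepPath_of_ge (hσ : 0 < σ) (hr : 0 < r) (he : ‖e‖ = 1) {τ : ℝ}
    (h : hitTime V r T₁ p e ℓ + turnTime σ r ≤ τ) :
    stepPath V σ r T₁ p e ℓ τ = ℓ (hitTime V r T₁ p e ℓ + turnTime σ r)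
      + orbit σ r (p - (V * hitTime V r T₁ p e ℓ) • e
      - ℓ (hitTime V r T₁ p e ℓ)) e (turnTime σ r)
      - (V * (τ - (hitTime V r T₁ p e ℓ + turnTime σ r))) • e := by
  have hT := turnTime_pos hσ hr
  rcases h.eq_or_lt with h | h
  · rw [stepPath_of_mem hσ hr he (by linarith) h.ge, ← h]
    simp
  · have h2 : ¬ τ ≤ hitTime V r T₁ p e ℓ := by linarith
    simp [stepPath, h.not_ge, h2]

lemma SpeedOn.continuousOn {v : ℝ} {γ : ℝ → Plane} {A : Set ℝ} (h : SpeedOn v γ A) :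
    ContinuousOn γ A := by
  have : LipschitzOnWith v.toNNReal γ A := by
    refine LipschitzOnWith.of_dist_le_mul fun s hs t ht => ?_
    rcases le_total s t with hst | hst
    · rw [dist_comm, dist_eq_norm, dist_comm s t, Real.dist_eq, abs_of_nonneg (by linarith)]
      exact (h s hs t ht hst).trans
        (mul_le_mul_of_nonneg_right (Real.le_coe_toNNReal v) (by linarith))
    · rw [dist_eq_norm, Real.dist_eq, abs_of_nonneg (by linarith)]
      exact (h t ht s hs hst).trans
        (mul_le_mul_of_nonneg_right (Real.le_coe_toNNReal v) (by linarith))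
  exact this.continuousOn

lemma stepPath_zero (hT₁ : 0 ≤ T₁) (hℓ : SpeedOn 1 ℓ (Set.Ici 0)) :
    stepPath V σ r T₁ p e ℓ 0 = p := by
  rw [stepPath_of_le (hitTime_mem hT₁ hℓ.continuousOn).1]
  simp

/-- While circling, the man adds a relative displacement of speed `σ` to that of the lion; this
needs `1 + σ ≤ V`. -/
lemma speedOn_stepPath (hσ : 0 < σ) (hr : 0 < r) (hT₁ : 0 ≤ T₁) (hV : 1 + σ ≤ V) (he : ‖e‖ = 1)
    (hℓ : SpeedOn 1 ℓ (Set.Ici 0)) (c : ℝ) :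
    SpeedOn V (stepPath V σ r T₁ p e ℓ) (Set.Icc 0 c) := by
  have hT := turnTime_pos hσ hr
  have ha := (hitTime_mem (V := V) (r := r) (p := p) (e := e) hT₁ hℓ.continuousOn).1
  have h₁ : SpeedOn V (stepPath V σ r T₁ p e ℓ) (Set.Icc 0 (hitTime V r T₁ p e ℓ)) := by
    refine (speedOn_run p e he (by linarith) 0 _).congr fun τ hτ => ?_
    simp only [stepPath_of_le hτ.2, sub_zero]
  have h₂ : SpeedOn V (stepPath V σ r T₁ p e ℓ) (Set.Icc (hitTime V r T₁ p e ℓ)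
      (hitTime V r T₁ p e ℓ + turnTime σ r)) := by
    intro s hs t ht hst
    rw [stepPath_of_mem hσ hr he hs.1 hs.2, stepPath_of_mem hσ hr he ht.1 ht.2]
    have e₁ := hℓ s (ha.trans hs.1) t (ha.trans ht.1) hst
    have e₂ := (orbit_spec hσ hr (p - (V * hitTime V r T₁ p e ℓ) • e
      - ℓ (hitTime V r T₁ p e ℓ)) he).2.2.1 (s - hitTime V r T₁ p e ℓ) trivial
      (t - hitTime V r T₁ p e ℓ) trivial (by linarith)
    rw [add_sub_add_comm]
    refine (norm_add_le _ _).trans ((add_le_add e₁ e₂).trans ?_)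
    nlinarith
  have h₃ : SpeedOn V (stepPath V σ r T₁ p e ℓ)
      (Set.Icc (hitTime V r T₁ p e ℓ + turnTime σ r) c) := by
    exact (speedOn_run _ e he (by linarith) _ _).congr fun τ hτ => stepPath_of_ge hσ hr he hτ.1
  exact (h₁.glue h₂).glue h₃

/-- During the evasive step the man is never closer than `r` to the lion. -/
lemma le_norm_stepPath_sub (hσ : 0 < σ) (hr : 0 < r) (hT₁ : 0 ≤ T₁) (hV : 1 + σ ≤ V)
    (he : ‖e‖ = 1) (hℓ : SpeedOn 1 ℓ (Set.Ici 0)) (h0 : r ≤ ‖p - ℓ 0‖) {τ : ℝ} (hτ0 : 0 ≤ τ)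
    (hτ : τ ≤ T₁ + turnTime σ r) :
    r ≤ ‖stepPath V σ r T₁ p e ℓ τ - ℓ τ‖ := by
  have hT := turnTime_pos hσ hr
  obtain ⟨ha, haT, hhit⟩ :=
    hitTime_mem (V := V) (r := r) (p := p) (e := e) hT₁ hℓ.continuousOn
  have hya := le_norm_of_le_hitTime (V := V) (e := e) hT₁ hℓ.continuousOn h0 ha le_rfl
  obtain ⟨-, ho₁, -, ho₂⟩ := orbit_spec hσ hr (p - (V * hitTime V r T₁ p e ℓ) • e
      - ℓ (hitTime V r T₁ p e ℓ)) he
  rcases le_total τ (hitTime V r T₁ p e ℓ) with h₁ | h₁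
  · rw [stepPath_of_le h₁]
    exact le_norm_of_le_hitTime hT₁ hℓ.continuousOn h0 hτ0 h₁
  rcases le_or_gt τ (hitTime V r T₁ p e ℓ + turnTime σ r) with h₂ | h₂
  · rw [stepPath_of_mem hσ hr he h₁ h₂, add_sub_cancel_left, ho₁]
    exact hya
  -- The second run falls within the step only after a genuine encounter. The orbit then started at
  -- distance exactly `r` and ended at `-r • e` from the lion, so the man runs straight away from
  -- that point, gaining `V` per unit time while the lion makes up at most `1`.
  · have hlt : hitTime V r T₁ p e ℓ ≠ T₁ := by
      intro h
      rw [h] at h₂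
      linarith
    rw [stepPath_of_ge hσ hr he h₂.le, ho₂ (le_antisymm (hhit.resolve_right hlt) hya)]
    set b := hitTime V r T₁ p e ℓ + turnTime σ r
    have hℓb := hℓ b (by change 0 ≤ b; linarith) τ hτ0 h₂.le
    have hrun : ‖-((r + V * (τ - b)) • e)‖ = r + V * (τ - b) := by
      rw [norm_neg, norm_smul, he, mul_one, Real.norm_of_nonneg]
      nlinarith
    have hsplit : ℓ b + -(r • e) - (V * (τ - b)) • e - ℓ τ
        = -((r + V * (τ - b)) • e) - (ℓ τ - ℓ b) := by
      module
    rw [hsplit]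
    have := norm_sub_norm_le (-((r + V * (τ - b)) • e)) (ℓ τ - ℓ b)
    nlinarith

/-- Up to an error of `V * turnTime σ r`, the evasive step is a run with velocity `-V • e`. -/
lemma norm_stepPath_end_sub_le (hσ : 0 < σ) (hr : 0 < r) (hT₁ : 0 ≤ T₁) (hV : 1 + σ ≤ V)
    (he : ‖e‖ = 1) (hℓ : SpeedOn 1 ℓ (Set.Ici 0)) :
    ‖stepPath V σ r T₁ p e ℓ (T₁ + turnTime σ r) - (p - (V * T₁) • e)‖ ≤ V * turnTime σ r := by
  have hT := turnTime_pos hσ hr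
  obtain ⟨ha, haT, -⟩ :=
    hitTime_mem (V := V) (r := r) (p := p) (e := e) hT₁ hℓ.continuousOn
  -- The two runs last `T₁` in total, so the error is exactly the displacement during the orbit.
  have hs := speedOn_stepPath (p := p) hσ hr hT₁ hV he hℓ (T₁ + turnTime σ r)
    (hitTime V r T₁ p e ℓ) ⟨ha, by linarith⟩ (hitTime V r T₁ p e ℓ + turnTime σ r)
    ⟨by linarith, by linarith⟩ (by linarith)
  rw [stepPath_of_ge hσ hr he le_rfl, stepPath_of_le le_rfl] at hs
  rw [stepPath_of_ge hσ hr he (by linarith)]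
  convert hs using 2
  · module
  · ring

/-- If either hitting time has come by `τ`, the two coincide; otherwise both men are still on the
same initial run. -/
lemma stepPath_congr (hT₁ : 0 ≤ T₁) (hσ : 0 < σ) (hr : 0 < r)
    (hℓ : SpeedOn 1 ℓ (Set.Ici 0)) (hℓ' : SpeedOn 1 ℓ' (Set.Ici 0)) {τ : ℝ} (hτ : 0 ≤ τ)
    (h : ∀ s, 0 ≤ s → s ≤ τ → ℓ s = ℓ' s) :
    stepPath V σ r T₁ p e ℓ τ = stepPath V σ r T₁ p e ℓ' τ := by
  have hT := turnTime_pos hσ hr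
  have hsymm : ∀ s, 0 ≤ s → s ≤ τ → ℓ' s = ℓ s := fun s h0 hs => (h s h0 hs).symm
  by_cases h₁ : hitTime V r T₁ p e ℓ ≤ τ ∨ hitTime V r T₁ p e ℓ' ≤ τ
  · have heq : hitTime V r T₁ p e ℓ = hitTime V r T₁ p e ℓ' := by
      rcases h₁ with h₁ | h₁
      · exact hitTime_congr hT₁ hℓ.continuousOn hℓ'.continuousOn h h₁
      · exact (hitTime_congr hT₁ hℓ'.continuousOn hℓ.continuousOn hsymm h₁).symm
    have ha := (hitTime_mem (V := V) (r := r) (p := p) (e := e) hT₁ hℓ.continuousOn).1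
    have hle : hitTime V r T₁ p e ℓ ≤ τ := by
      rcases h₁ with h₁ | h₁
      · exact h₁
      · rwa [heq]
    simp only [stepPath, ← heq, ← h _ ha hle, ← h _ hτ le_rfl]
    split_ifs with h₂ h₃
    · rfl
    · rfl
    · rw [h _ (by linarith) (by linarith)]
  · rw [not_or, not_le, not_le] at h₁
    rw [stepPath_of_le h₁.1.le, stepPath_of_le h₁.2.le]

end stepPath

/-! ### Following the guide by repeated evasive steps. -/

/-- The length of an evasive step. -/
noncomputable def stepTime (σ r T₁ : ℝ) : ℝ := T₁ + turnTime σ r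

/-- The positions at the multiples of `stepTime σ r T₁` of a man who performs evasive steps towards
the guide `g`. -/
noncomputable def waypoint (V σ r T₁ : ℝ) (g ℓ : ℝ → Plane) : ℕ → Plane
  | 0 => g 0
  | k + 1 => stepPath V σ r T₁ (waypoint V σ r T₁ g ℓ k)
      (direction (waypoint V σ r T₁ g ℓ k - g (k * stepTime σ r T₁)))
      (fun τ => ℓ (k * stepTime σ r T₁ + τ)) (stepTime σ r T₁)

/-- The evasive step that starts at time `k * stepTime σ r T₁`. -/
noncomputable def stepAt (V σ r T₁ : ℝ) (g ℓ : ℝ → Plane) (k : ℕ) : ℝ → Plane :=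
  stepPath V σ r T₁ (waypoint V σ r T₁ g ℓ k)
    (direction (waypoint V σ r T₁ g ℓ k - g (k * stepTime σ r T₁)))
    (fun τ => ℓ (k * stepTime σ r T₁ + τ))

/-- The path of a man who follows the guide `g` and evades the lion `ℓ`. -/
noncomputable def dodge (V σ r T₁ : ℝ) (g ℓ : ℝ → Plane) (t : ℝ) : Plane :=
  stepAt V σ r T₁ g ℓ ⌊t / stepTime σ r T₁⌋₊ (t - ⌊t / stepTime σ r T₁⌋₊ * stepTime σ r T₁)

section dodge

variable {v V σ r T₁ : ℝ} {g g' ℓ ℓ' : ℝ → Plane}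

lemma stepTime_pos (hσ : 0 < σ) (hr : 0 < r) (hT₁ : 0 ≤ T₁) : 0 < stepTime σ r T₁ :=
  add_pos_of_nonneg_of_pos hT₁ (turnTime_pos hσ hr)

lemma SpeedOn.shift {v a : ℝ} {γ : ℝ → Plane} (h : SpeedOn v γ (Set.Ici 0)) (ha : 0 ≤ a) :
    SpeedOn v (fun τ => γ (a + τ)) (Set.Ici 0) := by
  intro s hs t ht hst
  have := h (a + s) (add_nonneg ha hs) (a + t) (add_nonneg ha ht) (by linarith)
  simpa using this

lemma SpeedOn.shift_grid (hσ : 0 < σ) (hr : 0 < r) (hT₁ : 0 ≤ T₁) {w : ℝ} {γ : ℝ → Plane}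
    (h : SpeedOn w γ (Set.Ici 0)) (k : ℕ) :
    SpeedOn w (fun τ => γ (k * stepTime σ r T₁ + τ)) (Set.Ici 0) :=
  h.shift (mul_nonneg k.cast_nonneg (stepTime_pos hσ hr hT₁).le)

lemma stepAt_zero (hσ : 0 < σ) (hr : 0 < r) (hT₁ : 0 ≤ T₁) (hℓ : SpeedOn 1 ℓ (Set.Ici 0)) (k : ℕ) :
    stepAt V σ r T₁ g ℓ k 0 = waypoint V σ r T₁ g ℓ k :=
  stepPath_zero hT₁ (hℓ.shift_grid hσ hr hT₁ k)

/-- The right endpoint is included although the floor there is already `k + 1`: the next step starts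
where this one ends. Closed intervals are what gluing needs. -/
lemma dodge_eq_stepAt (hσ : 0 < σ) (hr : 0 < r) (hT₁ : 0 ≤ T₁) (hℓ : SpeedOn 1 ℓ (Set.Ici 0))
    (k : ℕ) {t : ℝ} (ht : k * stepTime σ r T₁ ≤ t) (ht' : t ≤ (k + 1 : ℕ) * stepTime σ r T₁) :
    dodge V σ r T₁ g ℓ t = stepAt V σ r T₁ g ℓ k (t - k * stepTime σ r T₁) := by
  have hS := stepTime_pos hσ hr hT₁
  have h0 : 0 ≤ t := le_trans (by positivity) ht
  rcases ht'.lt_or_eq with h | h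
  · have : ⌊t / stepTime σ r T₁⌋₊ = k := by
      rw [Nat.floor_eq_iff (by positivity), le_div_iff₀ hS, div_lt_iff₀ hS]
      exact ⟨ht, by exact_mod_cast h⟩
    rw [dodge, this]
  · have h2 : t - k * stepTime σ r T₁ = stepTime σ r T₁ := by
      rw [h]; push_cast; ring
    have : ⌊t / stepTime σ r T₁⌋₊ = k + 1 := by
      rw [h, mul_div_cancel_right₀ _ hS.ne', Nat.floor_natCast]
    rw [dodge, this, h2, h, sub_self, stepAt_zero hσ hr hT₁ hℓ]
    rfl

/-- The step that contains a given time. -/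
lemma exists_step (hσ : 0 < σ) (hr : 0 < r) (hT₁ : 0 ≤ T₁) {t : ℝ} (ht : 0 ≤ t) :
    ∃ k : ℕ, k * stepTime σ r T₁ ≤ t ∧ t ≤ (k + 1 : ℕ) * stepTime σ r T₁ := by
  have hS := stepTime_pos hσ hr hT₁
  refine ⟨⌊t / stepTime σ r T₁⌋₊, ?_, ?_⟩
  · exact (le_div_iff₀ hS).1 (Nat.floor_le (by positivity))
  · have := (Nat.lt_floor_add_one (t / stepTime σ r T₁)).le
    rw [div_le_iff₀ hS] at this
    exact_mod_cast this

lemma dodge_zero (hσ : 0 < σ) (hr : 0 < r) (hT₁ : 0 ≤ T₁) (hℓ : SpeedOn 1 ℓ (Set.Ici 0)) :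
    dodge V σ r T₁ g ℓ 0 = g 0 := by
  have hS := stepTime_pos hσ hr hT₁
  rw [dodge_eq_stepAt hσ hr hT₁ hℓ 0 (by simp) (by simpa using hS.le)]
  simpa using (stepAt_zero hσ hr hT₁ hℓ 0).trans (waypoint.eq_1 V σ r T₁ g ℓ)

lemma speedOn_dodge (hσ : 0 < σ) (hr : 0 < r) (hT₁ : 0 ≤ T₁) (hV : 1 + σ ≤ V)
    (hℓ : SpeedOn 1 ℓ (Set.Ici 0)) : SpeedOn V (dodge V σ r T₁ g ℓ) (Set.Ici 0) := by
  refine SpeedOn.of_grid (stepTime_pos hσ hr hT₁) fun k => ?_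
  intro s hs t ht hst
  rw [dodge_eq_stepAt hσ hr hT₁ hℓ k hs.1 hs.2, dodge_eq_stepAt hσ hr hT₁ hℓ k ht.1 ht.2]
  have := speedOn_stepPath (p := waypoint V σ r T₁ g ℓ k) hσ hr hT₁ hV (norm_direction
    (waypoint V σ r T₁ g ℓ k - g (k * stepTime σ r T₁))) (hℓ.shift_grid hσ hr hT₁ k)
    (t - k * stepTime σ r T₁) (s - k * stepTime σ r T₁) ⟨by linarith [hs.1], by linarith⟩
    (t - k * stepTime σ r T₁) ⟨by linarith [ht.1], le_rfl⟩ (by linarith)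
  simpa [stepAt] using this

lemma le_norm_waypoint_sub (hσ : 0 < σ) (hr : 0 < r) (hT₁ : 0 ≤ T₁) (hV : 1 + σ ≤ V)
    (hℓ : SpeedOn 1 ℓ (Set.Ici 0)) (h0 : r ≤ ‖g 0 - ℓ 0‖) (k : ℕ) :
    r ≤ ‖waypoint V σ r T₁ g ℓ k - ℓ (k * stepTime σ r T₁)‖ := by
  induction k with
  | zero => simpa [waypoint] using h0
  | succ k ih =>
    have hS := stepTime_pos hσ hr hT₁
    have := le_norm_stepPath_sub hσ hr hT₁ hV (norm_direction
      (waypoint V σ r T₁ g ℓ k - g (k * stepTime σ r T₁))) (hℓ.shift_grid hσ hr hT₁ k)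
      (by simpa using ih) hS.le le_rfl
    rw [waypoint]
    convert this using 4
    push_cast; ring

lemma le_norm_dodge_sub (hσ : 0 < σ) (hr : 0 < r) (hT₁ : 0 ≤ T₁) (hV : 1 + σ ≤ V)
    (hℓ : SpeedOn 1 ℓ (Set.Ici 0)) (h0 : r ≤ ‖g 0 - ℓ 0‖) {t : ℝ} (ht : 0 ≤ t) :
    r ≤ ‖dodge V σ r T₁ g ℓ t - ℓ t‖ := by
  obtain ⟨k, hk, hk'⟩ := exists_step hσ hr hT₁ ht
  rw [dodge_eq_stepAt hσ hr hT₁ hℓ k hk hk']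
  have := le_norm_stepPath_sub hσ hr hT₁ hV (norm_direction
    (waypoint V σ r T₁ g ℓ k - g (k * stepTime σ r T₁))) (hℓ.shift_grid hσ hr hT₁ k)
    (by simpa using le_norm_waypoint_sub hσ hr hT₁ hV hℓ h0 k)
    (τ := t - k * stepTime σ r T₁) (by linarith)
    (by push_cast at hk'; change _ ≤ stepTime σ r T₁; linarith)
  simpa [stepAt] using this

/-- At the ends of the evasive steps the man is close to the guide. -/
lemma norm_waypoint_sub_le (hσ : 0 < σ) (hr : 0 < r) (hT₁ : 0 ≤ T₁) (hv : 1 ≤ v) (hV : V = v + σ)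
    (hturn : 2 * V * turnTime σ r ≤ σ * T₁)
    (hg : SpeedOn v g (Set.Ici 0)) (hℓ : SpeedOn 1 ℓ (Set.Ici 0)) (k : ℕ) :
    ‖waypoint V σ r T₁ g ℓ k - g (k * stepTime σ r T₁)‖ ≤ 2 * V * T₁ := by
  have hS := stepTime_pos hσ hr hT₁
  have hT := turnTime_pos hσ hr
  induction k with
  | zero =>
    simp only [waypoint, Nat.cast_zero, zero_mul, sub_self, norm_zero]
    rw [hV]; positivity
  | succ k ih =>
    set x := waypoint V σ r T₁ g ℓ k - g (k * stepTime σ r T₁) with hx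
    have hend := norm_stepPath_end_sub_le (p := waypoint V σ r T₁ g ℓ k) hσ hr hT₁
      (by linarith : 1 + σ ≤ V) (norm_direction x) (hℓ.shift_grid hσ hr hT₁ k)
    have hgk := hg.shift_grid hσ hr hT₁ k 0 Set.self_mem_Ici (stepTime σ r T₁) hS.le hS.le
    have hrun : ‖x - (V * T₁) • direction x‖ = |‖x‖ - V * T₁| := by
      have : x - (V * T₁) • direction x = (‖x‖ - V * T₁) • direction x := by
        rw [sub_smul, ← norm_smul_direction]
      rw [this, norm_smul, norm_direction, mul_one, Real.norm_eq_abs]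
    have hcast : ((k + 1 : ℕ) : ℝ) * stepTime σ r T₁ = k * stepTime σ r T₁ + stepTime σ r T₁ := by
      push_cast; ring
    have hsplit : waypoint V σ r T₁ g ℓ (k + 1) - g ((k + 1 : ℕ) * stepTime σ r T₁)
        = (waypoint V σ r T₁ g ℓ (k + 1)
            - (waypoint V σ r T₁ g ℓ k - (V * T₁) • direction x))
          + (x - (V * T₁) • direction x)
          - (g (k * stepTime σ r T₁ + stepTime σ r T₁) - g (k * stepTime σ r T₁ + 0)) := by
      rw [hcast, hx, add_zero]; abel
    have hend' : ‖waypoint V σ r T₁ g ℓ (k + 1)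
        - (waypoint V σ r T₁ g ℓ k - (V * T₁) • direction x)‖ ≤ V * turnTime σ r := hend
    rw [hsplit]
    refine (norm_sub_le _ _).trans ((add_le_add_left (norm_add_le _ _) _).trans ?_)
    rw [hrun]
    have hbound : v * (stepTime σ r T₁ - 0) ≤ v * T₁ + V * turnTime σ r := by
      rw [stepTime, sub_zero, mul_add, hV]
      nlinarith
    have hVT : V * T₁ = v * T₁ + σ * T₁ := by rw [hV]; ring
    have hvT : 0 ≤ v * T₁ := by positivity
    have hσT : 0 ≤ σ * T₁ := by positivity
    -- If `‖x‖ ≥ V * T₁`, the surplus `σ * T₁` covers the cost `2 * V * turnTime σ r` of the detour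
    -- and the distance does not grow. Otherwise the man may overshoot, but the new distance is at
    -- most `(V + v + σ) * T₁ = 2 * V * T₁`.
    rcases abs_cases (‖x‖ - V * T₁) with ⟨h, -⟩ | ⟨h, -⟩ <;> rw [h] <;>
      linarith [norm_nonneg x]

lemma norm_dodge_sub_le (hσ : 0 < σ) (hr : 0 < r) (hT₁ : 0 ≤ T₁) (hv : 1 ≤ v) (hV : V = v + σ)
    (hturn : 2 * V * turnTime σ r ≤ σ * T₁)
    (hg : SpeedOn v g (Set.Ici 0)) (hℓ : SpeedOn 1 ℓ (Set.Ici 0)) {t : ℝ} (ht : 0 ≤ t) :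
    ‖dodge V σ r T₁ g ℓ t - g t‖ ≤ 5 * V * T₁ := by
  have hS := stepTime_pos hσ hr hT₁
  obtain ⟨k, hk, hk'⟩ := exists_step hσ hr hT₁ ht
  have hk0 : 0 ≤ k * stepTime σ r T₁ := by positivity
  have h₁ := speedOn_dodge (g := g) hσ hr hT₁ (by linarith : 1 + σ ≤ V) hℓ _ hk0 t ht hk
  have h₂ := hg _ hk0 t ht hk
  have h₃ := norm_waypoint_sub_le hσ hr hT₁ hv hV hturn hg hℓ k
  have h₄ : dodge V σ r T₁ g ℓ (k * stepTime σ r T₁) = waypoint V σ r T₁ g ℓ k := by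
    rw [dodge_eq_stepAt hσ hr hT₁ hℓ k le_rfl (by push_cast; linarith), sub_self,
      stepAt_zero hσ hr hT₁ hℓ]
  rw [h₄] at h₁
  have hsplit : dodge V σ r T₁ g ℓ t - g t = (dodge V σ r T₁ g ℓ t - waypoint V σ r T₁ g ℓ k)
      + (waypoint V σ r T₁ g ℓ k - g (k * stepTime σ r T₁))
      - (g t - g (k * stepTime σ r T₁)) := by abel
  rw [hsplit]
  refine (norm_sub_le _ _).trans ((add_le_add_left (norm_add_le _ _) _).trans ?_)
  have hd : t - k * stepTime σ r T₁ ≤ T₁ + turnTime σ r := by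
    push_cast at hk'; change _ ≤ stepTime σ r T₁; linarith
  have hd0 : 0 ≤ t - k * stepTime σ r T₁ := by linarith
  -- Since the last waypoint, man and guide together moved at most `2 * V * (T₁ + turnTime σ r) ≤ 3
  -- * V * T₁`; the waypoint contributes the other `2 * V * T₁`.
  have h₅ : V * (t - k * stepTime σ r T₁) ≤ V * (T₁ + turnTime σ r) :=
    mul_le_mul_of_nonneg_left hd (by linarith)
  have h₆ : v * (t - k * stepTime σ r T₁) ≤ V * (t - k * stepTime σ r T₁) :=
    mul_le_mul_of_nonneg_right (by linarith) hd0
  have h₇ : σ * T₁ ≤ V * T₁ := mul_le_mul_of_nonneg_right (by linarith) hT₁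
  linarith

lemma stepAt_congr_of_waypoint_eq (hσ : 0 < σ) (hr : 0 < r) (hT₁ : 0 ≤ T₁)
    (hℓ : SpeedOn 1 ℓ (Set.Ici 0)) (hℓ' : SpeedOn 1 ℓ' (Set.Ici 0)) {t : ℝ}
    (hg : ∀ s, 0 ≤ s → s ≤ t → g s = g' s) (h : ∀ s, 0 ≤ s → s ≤ t → ℓ s = ℓ' s) {k : ℕ}
    (hk : waypoint V σ r T₁ g ℓ k = waypoint V σ r T₁ g' ℓ' k) {τ : ℝ} (hτ : 0 ≤ τ)
    (hτt : k * stepTime σ r T₁ + τ ≤ t) :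
    stepAt V σ r T₁ g ℓ k τ = stepAt V σ r T₁ g' ℓ' k τ := by
  have hk0 : 0 ≤ k * stepTime σ r T₁ :=
    mul_nonneg k.cast_nonneg (stepTime_pos hσ hr hT₁).le
  rw [stepAt, stepAt, hk, hg _ hk0 (by linarith)]
  exact stepPath_congr hT₁ hσ hr (hℓ.shift_grid hσ hr hT₁ k) (hℓ'.shift_grid hσ hr hT₁ k) hτ
    fun s hs0 hs => h _ (by linarith) (by linarith)

lemma dodge_congr (hσ : 0 < σ) (hr : 0 < r) (hT₁ : 0 ≤ T₁) (hℓ : SpeedOn 1 ℓ (Set.Ici 0))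
    (hℓ' : SpeedOn 1 ℓ' (Set.Ici 0)) {t : ℝ} (ht : 0 ≤ t)
    (hg : ∀ s, 0 ≤ s → s ≤ t → g s = g' s) (h : ∀ s, 0 ≤ s → s ≤ t → ℓ s = ℓ' s) :
    dodge V σ r T₁ g ℓ t = dodge V σ r T₁ g' ℓ' t := by
  have hS := stepTime_pos hσ hr hT₁
  have hw : ∀ k : ℕ, k * stepTime σ r T₁ ≤ t →
      waypoint V σ r T₁ g ℓ k = waypoint V σ r T₁ g' ℓ' k := by
    intro k
    induction k with
    | zero => exact fun _ => hg 0 le_rfl ht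
    | succ k ih =>
      intro hk
      push_cast at hk
      exact stepAt_congr_of_waypoint_eq hσ hr hT₁ hℓ hℓ' hg h (ih (by linarith)) hS.le
        (by linarith)
  obtain ⟨k, hk, hk'⟩ := exists_step hσ hr hT₁ ht
  rw [dodge_eq_stepAt hσ hr hT₁ hℓ k hk hk', dodge_eq_stepAt hσ hr hT₁ hℓ' k hk hk']
  exact stepAt_congr_of_waypoint_eq hσ hr hT₁ hℓ hℓ' hg h (hw k hk) (by linarith) (by linarith)

end dodge

/-! ### One lion, then all lions successively. -/

/-- Evading one lion: a man who is slightly faster than a guide of speed at most `v` can follow the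
guide at distance at most `δ` and keep a distance `c` from a lion, where `c` depends only on the
speeds, on `δ` and on a lower bound `d` for the initial distance. -/
theorem exists_evasion (v V δ d : ℝ) (hv : 1 ≤ v) (hV : v < V) (hδ : 0 < δ) (hd : 0 < d) :
    ∃ (c : ℝ) (Φ : (ℝ → Plane) → (ℝ → Plane) → ℝ → Plane), 0 < c ∧
      (∀ g ℓ, SpeedOn v g (Set.Ici 0) → SpeedOn 1 ℓ (Set.Ici 0) → d ≤ ‖g 0 - ℓ 0‖ →
        Φ g ℓ 0 = g 0 ∧ SpeedOn V (Φ g ℓ) (Set.Ici 0) ∧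
        ∀ t, 0 ≤ t → ‖Φ g ℓ t - g t‖ ≤ δ ∧ c ≤ ‖Φ g ℓ t - ℓ t‖) ∧
      ∀ g g' ℓ ℓ' t, SpeedOn 1 ℓ (Set.Ici 0) → SpeedOn 1 ℓ' (Set.Ici 0) → 0 ≤ t →
        (∀ s, 0 ≤ s → s ≤ t → g s = g' s) → (∀ s, 0 ≤ s → s ≤ t → ℓ s = ℓ' s) →
        Φ g ℓ t = Φ g' ℓ' t := by
  have hσ : 0 < V - v := by linarith
  have hV0 : 0 < V := by linarith
  set T₁ := δ / (5 * V) with hT₁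
  have hT₁0 : 0 < T₁ := by positivity
  -- The second entry gives equality in `hturn`; the first makes the man start at distance at least
  -- `r`.
  set r := min d ((V - v) ^ 2 * T₁ / (4 * Real.pi * V)) with hr
  have hr0 : 0 < r := lt_min hd (by positivity)
  have hturn : 2 * V * turnTime (V - v) r ≤ (V - v) * T₁ := by
    have : r ≤ (V - v) ^ 2 * T₁ / (4 * Real.pi * V) := min_le_right _ _
    rw [le_div_iff₀ (by positivity)] at this
    rw [turnTime, ← mul_div_assoc, div_le_iff₀ hσ]
    linarith
  refine ⟨r, dodge V (V - v) r T₁, hr0, ?_, ?_⟩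
  · intro g ℓ hg hℓ h0
    refine ⟨dodge_zero hσ hr0 hT₁0.le hℓ, speedOn_dodge hσ hr0 hT₁0.le (by linarith) hℓ, ?_⟩
    intro t ht
    refine ⟨?_, le_norm_dodge_sub hσ hr0 hT₁0.le (by linarith) hℓ ((min_le_left _ _).trans h0) ht⟩
    have := norm_dodge_sub_le hσ hr0 hT₁0.le hv (by ring : V = v + (V - v)) hturn hg hℓ ht
    rwa [hT₁, mul_div_cancel₀ _ (by positivity)] at this
  · intro g g' ℓ ℓ' t hℓ hℓ' ht hg h
    exact dodge_congr hσ hr0 hT₁0.le hℓ hℓ' ht hg h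

/-- The paths `l i`, parametrized by real times, are paths of speed at most `1` from `l₀ i`. -/
def IsLions (l₀ : ℕ → Plane) (l : ℕ → ℝ → Plane) : Prop :=
  ∀ i, l i 0 = l₀ i ∧ SpeedOn 1 (l i) (Set.Ici 0)

/-- Successive evasion: the path `G n` evades the lion `n` and follows the path `G (n - 1)` so
closely that it still evades the lions before `n`. -/
theorem exists_evasion_sequence {ε : ℝ} (hε : 0 < ε) (m₀ : Plane) (l₀ : ℕ → Plane)
    (hl₀ : ∀ i, l₀ i ≠ m₀) :
    ∃ (G : ℕ → (ℕ → ℝ → Plane) → ℝ → Plane) (c δ : ℕ → ℝ),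
      (∀ n, 0 < c n) ∧ (∀ n, 0 < δ n) ∧ (∀ n, δ (n + 1) ≤ δ n / 2) ∧ (∀ n, δ n ≤ c n / 4) ∧
      (∀ n l, IsLions l₀ l → G n l 0 = m₀ ∧ SpeedOn (1 + ε) (G n l) (Set.Ici 0) ∧
        ∀ t, 0 ≤ t → c n ≤ ‖G n l t - l n t‖ ∧ ‖G n l t - G (n + 1) l t‖ ≤ δ n) ∧
      ∀ n l l', IsLions l₀ l → IsLions l₀ l' → ∀ t, 0 ≤ t →
        (∀ i ≤ n, ∀ s, 0 ≤ s → s ≤ t → l i s = l' i s) → G n l t = G n l' t := by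
  -- `cf` depends on the four numbers only, so all tolerances can be fixed before any lion moves.
  choose! cf Φ hc hΦ hcongr using exists_evasion
  let v : ℕ → ℝ := fun n => 1 + ε * (1 - (1 / 2) ^ n)
  have hv : ∀ n, 1 ≤ v n := fun n => by
    have : (1 / 2 : ℝ) ^ n ≤ 1 := pow_le_one₀ (by norm_num) (by norm_num)
    have := mul_nonneg hε.le (sub_nonneg.2 this)
    simp only [v]; linarith
  have hv1 : ∀ n, v n < v (n + 1) := fun n => by
    have : 0 < ε * (1 / 2 : ℝ) ^ n := by positivity
    simp only [v, pow_succ]; linarith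
  have hvε : ∀ n, v n ≤ 1 + ε := fun n => by
    have : 0 < ε * (1 / 2 : ℝ) ^ n := by positivity
    simp only [v]; linarith
  let d : ℕ → ℝ := fun n => ‖m₀ - l₀ n‖
  have hd : ∀ n, 0 < d n := fun n => norm_pos_iff.2 (sub_ne_zero.2 (hl₀ n).symm)
  -- `D n` is the tolerance with which path `n + 1` follows path `n`; the initial `1` is arbitrary.
  -- Halving makes the drift after path `n + 1` at most `2 * D (n + 1)`, and the quarter makes this
  -- at most `C n / 2`.
  let D : ℕ → ℝ := fun n => Nat.rec 1 (fun n D => min (D / 2) (cf (v n) (v (n + 1)) D (d n) / 4)) n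
  let C : ℕ → ℝ := fun n => cf (v n) (v (n + 1)) (D n) (d n)
  have hDsucc : ∀ n, D (n + 1) = min (D n / 2) (C n / 4) := fun n => rfl
  have hD : ∀ n, 0 < D n := by
    intro n
    induction n with
    | zero => exact one_pos
    | succ n ih =>
      rw [hDsucc]
      have : 0 < C n := hc _ _ _ _ (hv n) (hv1 n) ih (hd n)
      exact lt_min (by positivity) (by positivity)
  have hC : ∀ n, 0 < C n := fun n => hc _ _ _ _ (hv n) (hv1 n) (hD n) (hd n)
  let A : ℕ → (ℕ → ℝ → Plane) → ℝ → Plane := fun n =>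
    Nat.rec (fun _ _ => m₀) (fun n A l => Φ (v n) (v (n + 1)) (D n) (d n) (A l) (l n)) n
  have hA : ∀ n l, IsLions l₀ l → A n l 0 = m₀ ∧ SpeedOn (v n) (A n l) (Set.Ici 0) := by
    intro n l hl
    induction n with
    | zero =>
      refine ⟨rfl, fun s _ t _ hst => ?_⟩
      have : v 0 = 1 := by simp [v]
      change ‖m₀ - m₀‖ ≤ _
      rw [this, sub_self, norm_zero, one_mul]
      exact sub_nonneg.2 hst
    | succ n ih =>
      have := hΦ _ _ _ _ (hv n) (hv1 n) (hD n) (hd n) (A n l) (l n) ih.2 (hl n).2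
        (by rw [ih.1, (hl n).1])
      exact ⟨this.1.trans ih.1, this.2.1⟩
  have hA' : ∀ n l, IsLions l₀ l → ∀ t, 0 ≤ t →
      ‖A (n + 1) l t - A n l t‖ ≤ D n ∧ C n ≤ ‖A (n + 1) l t - l n t‖ := by
    intro n l hl
    exact (hΦ _ _ _ _ (hv n) (hv1 n) (hD n) (hd n) (A n l) (l n) (hA n l hl).2 (hl n).2
      (by rw [(hA n l hl).1, (hl n).1])).2.2
  -- The index shifts by one because `A 0`, the man resting at `m₀`, evades nobody.
  refine ⟨fun n => A (n + 1), C, fun n => D (n + 1), hC, fun n => hD (n + 1), fun n => ?_, fun n => ?_,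
    fun n l hl => ⟨(hA (n + 1) l hl).1, ?_, fun t ht => ⟨(hA' n l hl t ht).2, ?_⟩⟩, ?_⟩
  · exact (hDsucc (n + 1)).trans_le (min_le_left _ _)
  · exact (hDsucc n).trans_le (min_le_right _ _)
  · intro s hs t ht hst
    exact ((hA (n + 1) l hl).2 s hs t ht hst).trans
      (mul_le_mul_of_nonneg_right (hvε _) (sub_nonneg.2 hst))
  · rw [norm_sub_rev]; exact (hA' (n + 1) l hl t ht).1
  · have key : ∀ n l l', IsLions l₀ l → IsLions l₀ l' → ∀ t, 0 ≤ t →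
        (∀ i < n, ∀ s, 0 ≤ s → s ≤ t → l i s = l' i s) → A n l t = A n l' t := by
      intro n l l' hl hl'
      induction n with
      | zero => exact fun _ _ _ => rfl
      | succ n ih =>
        intro t ht h
        exact hcongr _ _ _ _ (hv n) (hv1 n) (hD n) (hd n) (A n l) (A n l') (l n) (l' n) t (hl n).2
          (hl' n).2 ht
          (fun s hs hst => ih s hs fun i hi u hu hus => h i (by omega) u hu (hus.trans hst))
          (h n (by omega))
    exact fun n l l' hl hl' t ht h =>
      key (n + 1) l l' hl hl' t ht fun i hi => h i (Nat.lt_succ_iff.1 hi)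

/-! ### Translation between paths on `ℝ≥0` and functions of real time. -/

namespace PathFrom

variable {v : ℝ} {p : Plane}

/-- A path as a function of real time. -/
noncomputable def onReal (γ : PathFrom v p) (t : ℝ) : Plane := γ.1 t.toNNReal

lemma onReal_coe (γ : PathFrom v p) (t : ℝ≥0) : onReal γ t = γ.1 t := by
  simp [onReal]

lemma onReal_zero (γ : PathFrom v p) : onReal γ 0 = p := by
  simp [onReal, γ.2.1]

lemma speedOn_onReal (γ : PathFrom v p) : SpeedOn v (onReal γ) (Set.Ici 0) := by
  intro s hs t ht hst
  have := γ.2.2 t.toNNReal s.toNNReal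
  rwa [Real.coe_toNNReal _ hs, Real.coe_toNNReal _ ht, abs_of_nonneg (sub_nonneg.2 hst)] at this

/-- A function of real time with the right speed and starting point as a path. -/
def ofReal (f : ℝ → Plane) (h0 : f 0 = p) (hf : SpeedOn v f (Set.Ici 0)) : PathFrom v p :=
  ⟨fun t => f t, by simpa using h0, fun s t => by
    rcases le_total s t with hst | hst
    · rw [norm_sub_rev, abs_sub_comm, abs_of_nonneg (sub_nonneg.2 (NNReal.coe_le_coe.2 hst))]
      exact hf _ s.2 _ t.2 hst
    · rw [abs_of_nonneg (sub_nonneg.2 (NNReal.coe_le_coe.2 hst))]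
      exact hf _ t.2 _ s.2 hst⟩

lemma continuous (γ : PathFrom v p) : Continuous γ.1 := by
  have : LipschitzWith v.toNNReal γ.1 := by
    refine LipschitzWith.of_dist_le_mul fun s t => ?_
    rw [dist_eq_norm, NNReal.dist_eq]
    exact (γ.2.2 s t).trans
      (mul_le_mul_of_nonneg_right (Real.le_coe_toNNReal v) (abs_nonneg _))
  exact this.continuous

/-- Two paths that agree before time `t` agree at time `t`. -/
lemma eq_of_eq_of_lt (γ γ' : PathFrom v p) {t : ℝ≥0} (h : ∀ s < t, γ.1 s = γ'.1 s) :
    ∀ s ≤ t, γ.1 s = γ'.1 s := by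
  rcases eq_or_ne t 0 with rfl | ht
  · intro s hs
    rw [nonpos_iff_eq_zero.1 hs, γ.2.1, γ'.2.1]
  · have hcl : closure (Set.Iio t) = Set.Iic t := closure_Iio' ⟨0, pos_iff_ne_zero.2 ht⟩
    have heq : Set.EqOn γ.1 γ'.1 (Set.Iio t) := h
    have := heq.closure (continuous γ) (continuous γ')
    rw [hcl] at this
    exact this

end PathFrom

lemma LionPaths.isLions {l₀ : ℕ → Plane} (l : LionPaths l₀) :
    IsLions l₀ fun i => PathFrom.onReal (l i) :=
  fun i => ⟨PathFrom.onReal_zero (l i), PathFrom.speedOn_onReal (l i)⟩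

lemma LionPaths.onReal_eq {ι : Type} {l₀ : ι → Plane} {l l' : LionPaths l₀} {t : ℝ≥0}
    (h : ∀ i, ∀ s < t, (l i).1 s = (l' i).1 s) (i : ι) (s : ℝ) (hs : s ≤ t) :
    PathFrom.onReal (l i) s = PathFrom.onReal (l' i) s :=
  PathFrom.eq_of_eq_of_lt (l i) (l' i) (h i) _ (Real.toNNReal_le_iff_le_coe.2 hs)

/-- Extension of paths of the lions `0, …, n` by resting lions. -/
def LionPaths.extend {l₀ : ℕ → Plane} {n : ℕ} (l : LionPaths (initialPoints l₀ n)) :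
    LionPaths l₀ := fun i =>
  if h : i < n + 1 then l ⟨i, h⟩
  else ⟨fun _ => l₀ i, rfl, fun s t => by simp⟩

lemma LionPaths.extend_of_le {l₀ : ℕ → Plane} {n : ℕ} (l : LionPaths (initialPoints l₀ n)) {i : ℕ}
    (hi : i ≤ n) : l.extend i = l ⟨i, Nat.lt_succ_of_le hi⟩ := by
  simp [LionPaths.extend, Nat.lt_succ_of_le hi]

/-- Terms of a sequence that at least halves in every step dominate the sums of their tails. -/
lemma halving_sum {δ : ℕ → ℝ} (hpos : ∀ n, 0 < δ n) (hδ : ∀ n, δ (n + 1) ≤ δ n / 2) :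
    Summable δ ∧ ∀ i, ∑' j, δ (i + j) ≤ 2 * δ i := by
  have hle : ∀ i j, δ (i + j) ≤ δ i * (1 / 2) ^ j := by
    intro i j
    induction j with
    | zero => simp
    | succ j ih =>
      rw [← add_assoc, pow_succ]
      linarith [hδ (i + j)]
  have hg : ∀ i, Summable fun j : ℕ => δ i * (1 / 2 : ℝ) ^ j := fun i =>
    summable_geometric_two.mul_left _
  have hs : ∀ i, Summable fun j => δ (i + j) := fun i =>
    Summable.of_nonneg_of_le (fun j => (hpos _).le) (hle i) (hg i)
  refine ⟨by simpa using hs 0, fun i => ?_⟩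
  calc ∑' j, δ (i + j) ≤ ∑' j, δ i * (1 / 2 : ℝ) ^ j := (hs i).tsum_le_tsum (hle i) (hg i)
    _ = 2 * δ i := by rw [tsum_mul_left, tsum_geometric_two, mul_comm]

end LionMan

/-! ### The limit strategy. -/

theorem theorem1 (ε : ℝ) (hε : 0 < ε) (m₀ : LionMan.Plane) (l₀ : ℕ → LionMan.Plane)
    (hl₀ : ∀ i, l₀ i ≠ m₀) :
    ∃ M : LionMan.Strategy ε m₀ l₀,
      M.Winning ∧
      ∃ (F : ∀ n : ℕ, LionMan.Strategy ε m₀ (LionMan.initialPoints l₀ n)) (c δ : ℕ → ℝ),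
        (∀ i, 0 < c i) ∧ (∀ n, 0 < δ n) ∧ Summable δ ∧
        (∀ i, ∑' j, δ (i + j) ≤ c i / 2) ∧
        (∀ n, (F n).Winning) ∧
        ∀ (l : LionMan.LionPaths l₀) (t : ℝ≥0),
          (∀ n, c n ≤ ‖((F n).path (l.initial n)).1 t - (l n).1 t‖) ∧
          (∀ n, ‖((F n).path (l.initial n)).1 t
              - ((F (n + 1)).path (l.initial (n + 1))).1 t‖ ≤ δ n) ∧
          (∀ n, ∀ i ≤ n, c i / 2 ≤ ‖((F n).path (l.initial n)).1 t - (l i).1 t‖) ∧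
          Tendsto (fun n => ((F n).path (l.initial n)).1 t) atTop (𝓝 ((M.path l).1 t)) ∧
          ∀ i, c i / 2 ≤ ‖(M.path l).1 t - (l i).1 t‖ := by
  classical
  obtain ⟨G, c, δ, hc, hδ, hhalf, hδc, hG, hcongr⟩ :=
    LionMan.exists_evasion_sequence hε m₀ l₀ hl₀
  obtain ⟨hsum, htail⟩ := LionMan.halving_sum hδ hhalf
  let R : LionMan.LionPaths l₀ → ℕ → ℝ → LionMan.Plane := fun l i =>
    LionMan.PathFrom.onReal (l i)
  have hR : ∀ l, LionMan.IsLions l₀ (R l) := fun l => l.isLions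
  -- Halving gives `δ m ≤ 2 * δ m - 2 * δ (m + 1)`, which telescopes.
  have hdist : ∀ l : LionMan.LionPaths l₀, ∀ t : ℝ, 0 ≤ t → ∀ i k,
      ‖G i (R l) t - G (i + k) (R l) t‖ ≤ 2 * δ i - 2 * δ (i + k) := by
    intro l t ht i k
    induction k with
    | zero => simp
    | succ k ih =>
      have h₁ := ((hG (i + k) (R l) (hR l)).2.2 t ht).2
      have h₂ := norm_sub_le_norm_sub_add_norm_sub (G i (R l) t) (G (i + k) (R l) t)
        (G (i + k + 1) (R l) t)
      rw [← add_assoc]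
      linarith [hhalf (i + k)]
  have hfar : ∀ l : LionMan.LionPaths l₀, ∀ t : ℝ≥0, ∀ n, ∀ i ≤ n,
      c i / 2 ≤ ‖G n (R l) t - (l i).1 t‖ := by
    intro l t n i hi
    obtain ⟨k, rfl⟩ := Nat.exists_eq_add_of_le hi
    have h₁ := hdist l t t.2 i k
    have h₂ := ((hG i (R l) (hR l)).2.2 t t.2).1
    have h₃ := norm_sub_le_norm_sub_add_norm_sub (G i (R l) t) (G (i + k) (R l) t) ((l i).1 t)
    simp only [R, LionMan.PathFrom.onReal_coe] at h₂
    linarith [hδ (i + k), hδc i]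
  have hlim : ∀ (l : LionMan.LionPaths l₀) (t : ℝ≥0),
      ∃ x, Tendsto (fun n => G n (R l) t) atTop (𝓝 x) := fun l t =>
    cauchySeq_tendsto_of_complete (cauchySeq_of_dist_le_of_summable δ
      (fun n => by rw [dist_eq_norm]; exact ((hG n (R l) (hR l)).2.2 t t.2).2) hsum)
  choose L hL using hlim
  have hGpath : ∀ l n (s t : ℝ≥0),
      ‖G n (R l) s - G n (R l) t‖ ≤ (1 + ε) * |(s : ℝ) - (t : ℝ)| := fun l n =>
    (LionMan.PathFrom.ofReal _ (hG n (R l) (hR l)).1 (hG n (R l) (hR l)).2.1).2.2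
  let M : LionMan.Strategy ε m₀ l₀ :=
    { path := fun l => ⟨L l, by
        refine tendsto_nhds_unique (hL l 0) ?_
        simp only [NNReal.coe_zero, (hG _ (R l) (hR l)).1]
        exact tendsto_const_nhds, fun s t =>
          le_of_tendsto ((hL l s).sub (hL l t)).norm (Eventually.of_forall fun n => hGpath l n s t)⟩
      nonanticipative := by
        intro l l' t h s hs
        refine tendsto_nhds_unique (hL l s) ((hL l' s).congr fun n => ?_)
        exact (hcongr n (R l) (R l') (hR l) (hR l') s s.2 fun i _ u _ hus =>
          LionMan.LionPaths.onReal_eq h i u (hus.trans hs)).symm }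
  -- The lions after `n` are padded in at rest; `G n` ignores them, so `hF` holds whatever they
  -- really do.
  let F : ∀ n : ℕ, LionMan.Strategy ε m₀ (LionMan.initialPoints l₀ n) := fun n =>
    { path := fun l => LionMan.PathFrom.ofReal (G n (R l.extend)) (hG n _ (hR _)).1
        (hG n _ (hR _)).2.1
      nonanticipative := by
        intro l l' t h s hs
        refine hcongr n (R l.extend) (R l'.extend) (hR _) (hR _) s s.2 fun i hi u _ hus => ?_
        simp only [R, LionMan.LionPaths.extend_of_le _ hi]
        exact LionMan.LionPaths.onReal_eq h ⟨i, Nat.lt_succ_of_le hi⟩ u (hus.trans hs) }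
  have hF : ∀ (l : LionMan.LionPaths l₀) n (t : ℝ≥0),
      ((F n).path (l.initial n)).1 t = G n (R l) t := by
    intro l n t
    refine hcongr n _ _ (hR _) (hR _) t t.2 fun i hi u _ _ => ?_
    simp only [R, LionMan.LionPaths.extend_of_le _ hi]
  -- Never being caught would not survive the limit; the uniform bound `c i / 2` does.
  have hMfar : ∀ (l : LionMan.LionPaths l₀) (t : ℝ≥0) i,
      c i / 2 ≤ ‖(M.path l).1 t - (l i).1 t‖ := fun l t i =>
    ge_of_tendsto ((hL l t).sub_const _).norm
      ((eventually_ge_atTop i).mono fun n hn => hfar l t n i hn)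
  have hne : ∀ {x y : LionMan.Plane} {i : ℕ}, c i / 2 ≤ ‖x - y‖ → x ≠ y := by
    intro x y i h hxy
    rw [hxy, sub_self, norm_zero] at h
    linarith [hc i]
  refine ⟨M, fun l t i => hne (hMfar l t i), F, c, δ, hc, hδ, hsum, fun i => ?_, ?_, ?_⟩
  · linarith [htail i, hδc i]
  · intro n l t i
    have := hfar l.extend t n i (Nat.lt_succ_iff.1 i.2)
    rw [LionMan.LionPaths.extend_of_le _ (Nat.lt_succ_iff.1 i.2)] at this
    exact hne this
  · intro l t
    simp only [hF]
    refine ⟨fun n => ?_, fun n => ((hG n (R l) (hR l)).2.2 t t.2).2, hfar l t, hL l t, hMfar l t⟩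
    simpa only [R, LionMan.PathFrom.onReal_coe] using ((hG n (R l) (hR l)).2.2 t t.2).1
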